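/- Let $q,\rho\in\mathbb{R}$ with $|q|<1$, $|\rho|<1$, and let $x\in S(q)=[-2/\sqrt{1-q},\,2/\sqrt{1-q}]$. Write $(a)_\infty=\prod_{j\ge 0}(1-aq^j)$, $[n]_q=1+q+\dots+q^{n-1}$ and $[n]_q!=\prod_{j=1}^n[j]_q$ (so $[0]_q!=1$). Let $H_n(x|q)=(1-q)^{-n/2}\,h_n\!\left(\tfrac{x\sqrt{1-q}}{2}\,\middle|\,q\right)$, where the continuous $q$-Hermite polynomials $h_n$ are given by $h_{-1}(x|q)=0$, $h_0(x|q)=1$ and $2x\,h_n(x|q)=h_{n+1}(x|q)+(1-q^n)h_{n-1}(x|q)$ for $n\ge 0$. Finally let $L_q(x|a)=(1+a)^2-(1-q)x^2a$. Then $(\rho)_\infty\neq 0$, $L_q(x|\rho q^k)\ne 0$ for every $k\ge 0$, the infinite product and the series below converge (unconditionally), and $$\sum_{k\ge 0}\frac{\rho^k(\rho q^{k+1})_\infty}{[k]_q!}\,H_{2k}(x|q)=\frac{(\rho^2)_\infty}{(\rho)_\infty}\prod_{k=0}^{\infty}L_q^{-1}(x|\rho q^k).$$ -/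

import Mathlib

/-- The infinite `q`-Pochhammer symbol `(a; q)_∞ = ∏_{j ≥ 0} (1 - a q^j)`. -/
noncomputable def qPochInf (a q : ℝ) : ℝ := ∏' j : ℕ, (1 - a * q ^ j)

/-- For `|q| < 1` the infinite product defining `(a; q)_∞` converges. -/
theorem multipliable_qPochInf (a : ℝ) {q : ℝ} (hq : |q| < 1) :
    Multipliable (fun j : ℕ => 1 - a * q ^ j) := by
  have hs : Summable (fun j : ℕ => ‖-(a * q ^ j)‖) := by
    have h := (summable_geometric_of_lt_one (abs_nonneg q) hq).mul_left |a|
    refine h.congr fun j => ?_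
    simp [abs_mul, abs_pow]
  refine (multipliable_one_add_of_summable hs).congr fun j => ?_
  ring

/-- The `q`-number `[n]_q = 1 + q + ⋯ + q^(n-1)`, with `[0]_q = 0`. -/
noncomputable def qNumber (q : ℝ) (n : ℕ) : ℝ := ∑ i ∈ Finset.range n, q ^ i

/-- The `q`-factorial `[n]_q! = [1]_q [2]_q ⋯ [n]_q`, with `[0]_q! = 1`. -/
noncomputable def qFact (q : ℝ) (n : ℕ) : ℝ := ∏ j ∈ Finset.range n, qNumber q (j + 1)

/-- The continuous `q`-Hermite polynomials `h_n(x|q)`: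
`h_0 = 1`, `h_1 = 2x` and `h_{n+1} = 2x h_n - (1 - q^n) h_{n-1}` for `n ≥ 1`. -/
noncomputable def qHermiteCont (q x : ℝ) : ℕ → ℝ
  | 0 => 1
  | 1 => 2 * x
  | n + 2 => 2 * x * qHermiteCont q x (n + 1) - (1 - q ^ (n + 1)) * qHermiteCont q x n

/-- The rescaled (monic) `q`-Hermite polynomials
`H_n(x|q) = (1-q)^(-n/2) h_n(x √(1-q) / 2 | q)`, for `q < 1`. -/
noncomputable def qHermite (q : ℝ) (n : ℕ) (x : ℝ) : ℝ :=
  (1 - q) ^ (-(n : ℝ) / 2) * qHermiteCont q (x * Real.sqrt (1 - q) / 2) n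

/-- The support interval `S(q) = [-2/√(1-q), 2/√(1-q)]`. -/
noncomputable def supportS (q : ℝ) : Set ℝ :=
  Set.Icc (-2 / Real.sqrt (1 - q)) (2 / Real.sqrt (1 - q))

/-- `l(x|a) = (1+a)^2 - 4 x^2 a`. -/
def lFactor (x a : ℝ) : ℝ := (1 + a) ^ 2 - 4 * x ^ 2 * a

/-- `L_q(x|a) = l(x √(1-q) / 2 | a)`, which for `q ≤ 1` is `(1+a)^2 - (1-q) x^2 a`. -/
noncomputable def LFactor (q x a : ℝ) : ℝ := lFactor (x * Real.sqrt (1 - q) / 2) a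

/-!
Write `x √(1 - q) = 2y` and let `T(ρ)` be the series. Creative telescoping in the summation index
shows that `l(y|ρ) T(ρ) = (1 + ρ) (1 - ρ² q) T(ρ q)`. Iterating and using `T(ρ qⁿ) → T(0) = 1` gives
`T(ρ) ∏ l(y|ρ qᵏ) = (-ρ; q)_∞ (ρ² q; q²)_∞`, and multiplication by `(ρ; q)_∞` turns the right-hand
side into `(ρ²; q²)_∞ (ρ² q; q²)_∞ = (ρ²; q)_∞`. Since this is nonzero, so are all `l(y|ρ qᵏ)`.

The series converges for `|y| ≤ 1` because `2y = z + z⁻¹` with `|z| = 1`, and the generating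
function of `h_n(y|q) / (q; q)_n` is the product of two `q`-exponentials, each a power series in `r`
with radius of convergence `1`.
-/

open Filter Topology Finset

theorem summable_mul_of_tendsto {f g : ℕ → ℝ} {c : ℝ} (hf : Summable f)
    (hg : Tendsto g atTop (𝓝 c)) : Summable fun n => f n * g n :=
  hf.norm.mul_tendsto_const (Nat.cofinite_eq_atTop ▸ hg)

/-! ### `q`-Pochhammer symbols -/

/-- The finite `q`-Pochhammer symbol `(a; q)_n`, the partial product of `qPochInf a q`. -/
noncomputable def qPochFin (a q : ℝ) (n : ℕ) : ℝ := ∏ j ∈ range n, (1 - a * q ^ j)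

section QPochhammer

variable {q : ℝ}

theorem abs_mul_pow_le (hq : |q| ≤ 1) (a : ℝ) (n : ℕ) : |a * q ^ n| ≤ |a| := by
  rw [abs_mul, abs_pow]
  exact mul_le_of_le_one_right (abs_nonneg a) (pow_le_one₀ (abs_nonneg q) hq)

theorem tendsto_mul_pow_nhds_zero (hq : |q| < 1) (a : ℝ) :
    Tendsto (fun n : ℕ => a * q ^ n) atTop (𝓝 0) := by
  simpa only [mul_zero] using (tendsto_pow_atTop_nhds_zero_of_abs_lt_one hq).const_mul a

theorem one_sub_mul_pow_ne_zero {a : ℝ} (hq : |q| < 1) (ha : |a| < 1) (n : ℕ) :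
    1 - a * q ^ n ≠ 0 :=
  sub_ne_zero.mpr ((abs_lt.mp ((abs_mul_pow_le hq.le a n).trans_lt ha)).2.ne')

theorem hasSum_abs_mul_pow (hq : |q| < 1) (a : ℝ) :
    HasSum (fun j : ℕ => |a * q ^ j|) (|a| * (1 - |q|)⁻¹) := by
  simpa only [abs_mul, abs_pow] using (hasSum_geometric_of_lt_one (abs_nonneg q) hq).mul_left |a|

@[simp]
theorem qPochFin_zero (a q : ℝ) : qPochFin a q 0 = 1 := prod_range_zero _

theorem qPochFin_succ (a q : ℝ) (n : ℕ) :
    qPochFin a q (n + 1) = qPochFin a q n * (1 - a * q ^ n) :=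
  prod_range_succ _ _

theorem qPochFin_ne_zero {a : ℝ} (hq : |q| < 1) (ha : |a| < 1) (n : ℕ) : qPochFin a q n ≠ 0 :=
  prod_ne_zero_iff.mpr fun j _ => one_sub_mul_pow_ne_zero hq ha j

theorem tendsto_qPochFin (hq : |q| < 1) (a : ℝ) :
    Tendsto (qPochFin a q) atTop (𝓝 (qPochInf a q)) :=
  (multipliable_qPochInf a hq).hasProd.tendsto_prod_nat

theorem qPochInf_ne_zero {a : ℝ} (hq : |q| < 1) (ha : |a| < 1) : qPochInf a q ≠ 0 := by
  simpa only [qPochInf, sub_eq_add_neg] using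
    tprod_one_add_ne_zero_of_summable (f := fun j : ℕ => -(a * q ^ j))
      (fun j => by simpa only [← sub_eq_add_neg] using one_sub_mul_pow_ne_zero hq ha j)
      (by simpa only [norm_neg, Real.norm_eq_abs] using (hasSum_abs_mul_pow hq a).summable)

theorem qPochInf_eq_one_sub_mul (hq : |q| < 1) (a : ℝ) :
    qPochInf a q = (1 - a) * qPochInf (a * q) q := by
  have shift (j : ℕ) : 1 - a * q ^ (j + 1) = 1 - a * q * q ^ j := by ring
  have h := tprod_eq_zero_mul' (f := fun j : ℕ => 1 - a * q ^ j)
    ((multipliable_qPochInf (a * q) hq).congr fun j => (shift j).symm)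
  simpa only [qPochInf, shift, pow_zero, mul_one] using h

theorem qPochInf_mul_qPochInf_neg (hq : |q| < 1) (a : ℝ) :
    qPochInf a q * qPochInf (-a) q = qPochInf (a ^ 2) (q ^ 2) := by
  rw [qPochInf, qPochInf,
    ← (multipliable_qPochInf a hq).tprod_mul (multipliable_qPochInf (-a) hq)]
  exact tprod_congr fun j => by ring

theorem qPochInf_sq_mul_qPochInf_sq (hq : |q| < 1) (a : ℝ) :
    qPochInf a (q ^ 2) * qPochInf (a * q) (q ^ 2) = qPochInf a q := by
  have hq2 : |q ^ 2| < 1 := by simpa only [abs_pow] using pow_lt_one₀ (abs_nonneg q) hq two_ne_zero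
  have even (k : ℕ) : 1 - a * (q ^ 2) ^ k = 1 - a * q ^ (2 * k) := by ring
  have odd (k : ℕ) : 1 - a * q * (q ^ 2) ^ k = 1 - a * q ^ (2 * k + 1) := by ring
  have h := tprod_even_mul_odd (f := fun j : ℕ => 1 - a * q ^ j)
    ((multipliable_qPochInf a hq2).congr even) ((multipliable_qPochInf (a * q) hq2).congr odd)
  simpa only [qPochInf, even, odd] using h

theorem abs_qPochInf_sub_one_le (hq : |q| < 1) (a : ℝ) :
    |qPochInf a q - 1| ≤ Real.exp (|a| * (1 - |q|)⁻¹) - 1 := by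
  refine le_of_tendsto ((tendsto_qPochFin hq a).sub_const 1).abs (Eventually.of_forall fun n => ?_)
  calc |qPochFin a q n - 1| ≤ Real.exp (∑ j ∈ range n, |a * q ^ j|) - 1 := by
        simpa only [qPochFin, sub_eq_add_neg, norm_neg, Real.norm_eq_abs] using
          (range n).norm_prod_one_add_sub_one_le fun j => -(a * q ^ j)
    _ ≤ Real.exp (|a| * (1 - |q|)⁻¹) - 1 := by
        gcongr
        exact sum_le_hasSum _ (fun _ _ => abs_nonneg _) (hasSum_abs_mul_pow hq a)

theorem abs_qPochInf_le (hq : |q| < 1) (a : ℝ) :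
    |qPochInf a q| ≤ Real.exp (|a| * (1 - |q|)⁻¹) := by
  have h := abs_sub_abs_le_abs_sub (qPochInf a q) 1
  rw [abs_one] at h
  linarith [abs_qPochInf_sub_one_le hq a]

theorem tendsto_qPochInf_nhds_zero (hq : |q| < 1) :
    Tendsto (fun a => qPochInf a q) (𝓝 0) (𝓝 1) := by
  refine tendsto_iff_norm_sub_tendsto_zero.mpr
    (squeeze_zero (fun _ => norm_nonneg _) (abs_qPochInf_sub_one_le hq) ?_)
  have hcont : Continuous fun a : ℝ => Real.exp (|a| * (1 - |q|)⁻¹) - 1 := by fun_prop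
  simpa using hcont.tendsto 0

theorem tendsto_qPochInf_mul_pow (hq : |q| < 1) (a : ℝ) :
    Tendsto (fun n : ℕ => qPochInf (a * q ^ n) q) atTop (𝓝 1) :=
  (tendsto_qPochInf_nhds_zero hq).comp (tendsto_mul_pow_nhds_zero hq a)

theorem tendsto_qPochFin_inv (hq : |q| < 1) :
    Tendsto (fun n => (qPochFin q q n)⁻¹) atTop (𝓝 (qPochInf q q)⁻¹) :=
  (tendsto_qPochFin hq q).inv₀ (qPochInf_ne_zero hq hq)

theorem qFact_mul_one_sub_pow (q : ℝ) (n : ℕ) : qFact q n * (1 - q) ^ n = qPochFin q q n := by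
  rw [qFact, qPochFin, ← card_range n, ← prod_const, card_range, ← prod_mul_distrib]
  exact prod_congr rfl fun j _ => by rw [qNumber, geom_sum_mul_neg, pow_succ']

end QPochhammer

/-! ### Continuous `q`-Hermite polynomials -/

/-- Euler's `q`-exponential series `∑ zⁿ Xⁿ / (q; q)_n`; the product of those for `z` and `z⁻¹` is
the generating function of the continuous `q`-Hermite polynomials at `(z + z⁻¹) / 2`. -/
noncomputable def qExpSeries (q : ℝ) (z : ℂ) : PowerSeries ℂ :=
  PowerSeries.mk fun n => z ^ n / qPochFin q q n

section QHermite

open PowerSeries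

variable {q y : ℝ} {z w : ℂ}

theorem rescale_qExpSeries (hq : |q| < 1) (z : ℂ) :
    rescale (q : ℂ) (qExpSeries q z) = (1 - C z * X) * qExpSeries q z := by
  ext n
  rw [coeff_rescale, sub_mul, one_mul, mul_assoc, map_sub, coeff_C_mul]
  cases n with
  | zero => simp [qExpSeries]
  | succ n =>
    have hD : (qPochFin q q n : ℂ) ≠ 0 := mod_cast qPochFin_ne_zero hq hq n
    have hD' : (1 - q * q ^ n : ℂ) ≠ 0 := mod_cast one_sub_mul_pow_ne_zero hq hq n
    simp only [coeff_succ_X_mul, qExpSeries, coeff_mk, qPochFin_succ]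
    push_cast
    field_simp
    ring

theorem coeff_qExpSeries_mul_recurrence (hq : |q| < 1) (hzw : z * w = 1) (n : ℕ) :
    (1 - (q : ℂ) ^ (n + 2)) * coeff (n + 2) (qExpSeries q z * qExpSeries q w) =
      (z + w) * coeff (n + 1) (qExpSeries q z * qExpSeries q w) -
        coeff n (qExpSeries q z * qExpSeries q w) := by
  set F := qExpSeries q z * qExpSeries q w
  have hC : (C z * C w : PowerSeries ℂ) = 1 := by rw [← map_mul, hzw, map_one]
  have hF : rescale (q : ℂ) F = F - C (z + w) * (X * F) + X * (X * F) := by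
    rw [map_mul, rescale_qExpSeries hq, rescale_qExpSeries hq, map_add]
    linear_combination X ^ 2 * F * hC
  have h := congrArg (coeff (n + 2)) hF
  rw [coeff_rescale, map_add, map_sub, coeff_C_mul, coeff_succ_X_mul, coeff_succ_X_mul,
    coeff_succ_X_mul] at h
  linear_combination -h

theorem coeff_qExpSeries_mul (hq : |q| < 1) (hzw : z * w = 1) (hy : z + w = 2 * y) :
    ∀ n, coeff n (qExpSeries q z * qExpSeries q w) = qHermiteCont q y n / qPochFin q q n
  | 0 => by simp [qExpSeries, qHermiteCont]
  | 1 => by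
    rw [coeff_mul, Nat.sum_antidiagonal_succ]
    simp [qExpSeries, qHermiteCont, qPochFin_succ, ← hy, add_div, add_comm]
  | n + 2 => by
    have hD : (qPochFin q q n : ℂ) ≠ 0 := mod_cast qPochFin_ne_zero hq hq n
    have hD1 : (1 - q ^ (n + 1) : ℂ) ≠ 0 := by
      simpa only [pow_succ'] using mod_cast one_sub_mul_pow_ne_zero hq hq n
    have hD2 : (1 - q ^ (n + 2) : ℂ) ≠ 0 := by
      simpa only [pow_succ' _ (n + 1)] using mod_cast one_sub_mul_pow_ne_zero hq hq (n + 1)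
    have h := coeff_qExpSeries_mul_recurrence hq hzw n
    rw [coeff_qExpSeries_mul hq hzw hy (n + 1), coeff_qExpSeries_mul hq hzw hy n, hy] at h
    rw [eq_div_of_mul_eq hD2 ((mul_comm _ _).trans h), qHermiteCont]
    simp only [qPochFin_succ, ← pow_succ']
    push_cast
    field_simp

theorem summable_norm_pow_div_qPochFin (hq : |q| < 1) (hz : ‖z‖ < 1) :
    Summable fun n => ‖z ^ n / qPochFin q q n‖ := by
  have h := summable_mul_of_tendsto (summable_norm_geometric_of_norm_lt_one hz)
    (tendsto_qPochFin_inv hq).abs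
  exact h.congr fun n => by
    rw [norm_div, Complex.norm_real, Real.norm_eq_abs, abs_inv, div_eq_mul_inv]

theorem summable_pow_mul_qHermiteCont {r : ℝ} (hq : |q| < 1) (hzw : z * w = 1)
    (hy : z + w = 2 * y) (hz : ‖r * z‖ < 1) (hw : ‖r * w‖ < 1) :
    Summable fun n => r ^ n * qHermiteCont q y n := by
  have h := summable_norm_sum_mul_antidiagonal_of_summable_norm
    (summable_norm_pow_div_qPochFin hq hz) (summable_norm_pow_div_qPochFin hq hw)
  have hcoeff (n : ℕ) : ∑ kl ∈ antidiagonal n, (r * z) ^ kl.1 / (qPochFin q q kl.1 : ℂ) *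
      ((r * w) ^ kl.2 / qPochFin q q kl.2) = (r ^ n * qHermiteCont q y n / qPochFin q q n : ℝ) := by
    push_cast
    rw [mul_div_assoc, ← coeff_qExpSeries_mul hq hzw hy, coeff_mul, mul_sum]
    refine sum_congr rfl fun kl hkl => ?_
    rw [← mem_antidiagonal.mp hkl, qExpSeries, qExpSeries, coeff_mk, coeff_mk]
    ring
  simp only [hcoeff, Complex.norm_real] at h
  refine (summable_mul_of_tendsto h.of_norm (tendsto_qPochFin hq q)).congr fun n => ?_
  exact div_mul_cancel₀ _ (qPochFin_ne_zero hq hq n)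

theorem summable_pow_mul_qHermiteCont_of_abs_le_one {r : ℝ} (hq : |q| < 1) (hr : |r| < 1)
    (hy : |y| ≤ 1) : Summable fun n => r ^ n * qHermiteCont q y n := by
  set θ := Real.arccos y
  have hcos : Complex.cos θ = y := by
    rw [← Complex.ofReal_cos, Real.cos_arccos (abs_le.mp hy).1 (abs_le.mp hy).2]
  have hnorm (t : ℝ) : ‖r * Complex.exp (t * Complex.I)‖ < 1 := by
    rwa [norm_mul, Complex.norm_exp_ofReal_mul_I, mul_one, Complex.norm_real]
  refine summable_pow_mul_qHermiteCont hq (z := Complex.exp (θ * Complex.I))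
    (w := Complex.exp ((-θ : ℝ) * Complex.I)) ?_ ?_ (hnorm θ) (hnorm (-θ))
  · rw [← Complex.exp_add]
    simp
  · rw [← hcos, Complex.two_cos, Complex.ofReal_neg]

theorem summable_pow_mul_qHermiteCont_two_mul {a : ℝ} (hq : |q| < 1) (ha : |a| < 1)
    (hy : |y| ≤ 1) : Summable fun k => a ^ k * qHermiteCont q y (2 * k) := by
  have hr : |√(|a|)| < 1 := by
    rwa [abs_of_nonneg (Real.sqrt_nonneg _), Real.sqrt_lt' one_pos, one_pow]
  have h := (summable_pow_mul_qHermiteCont_of_abs_le_one hq hr hy).comp_injective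
    (mul_right_injective₀ (two_ne_zero (α := ℕ)))
  refine .of_norm (h.norm.congr fun k => ?_)
  simp only [Function.comp_apply, pow_mul, Real.sq_sqrt (abs_nonneg a), norm_mul, norm_pow,
    Real.norm_eq_abs, abs_abs]

theorem qHermiteCont_even_recurrence (q y : ℝ) (k : ℕ) :
    qHermiteCont q y (2 * (k + 2)) =
      (4 * y ^ 2 - 2 + q ^ (2 * k + 2) + q ^ (2 * k + 3)) * qHermiteCont q y (2 * (k + 1)) -
        (1 - q ^ (2 * k + 1)) * (1 - q ^ (2 * k + 2)) * qHermiteCont q y (2 * k) := by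
  have h2 : qHermiteCont q y (2 * (k + 1)) = 2 * y * qHermiteCont q y (2 * k + 1) -
    (1 - q ^ (2 * k + 1)) * qHermiteCont q y (2 * k) := rfl
  have h3 : qHermiteCont q y (2 * k + 3) = 2 * y * qHermiteCont q y (2 * (k + 1)) -
    (1 - q ^ (2 * k + 2)) * qHermiteCont q y (2 * k + 1) := rfl
  have h4 : qHermiteCont q y (2 * (k + 2)) = 2 * y * qHermiteCont q y (2 * k + 3) -
    (1 - q ^ (2 * k + 3)) * qHermiteCont q y (2 * (k + 1)) := rfl
  linear_combination h4 + 2 * y * h3 + (1 - q ^ (2 * k + 2)) * h2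

theorem qHermite_two_mul (hq : q < 1) (x : ℝ) (k : ℕ) :
    qHermite q (2 * k) x = qHermiteCont q (x * √(1 - q) / 2) (2 * k) / (1 - q) ^ k := by
  have hexp : -((2 * k : ℕ) : ℝ) / 2 = -(k : ℝ) := by push_cast; ring
  rw [qHermite, hexp, Real.rpow_neg (sub_nonneg.mpr hq.le), Real.rpow_natCast, inv_mul_eq_div]

end QHermite

/-! ### The diagonal series -/

/-- The terms of the diagonal series in the variable `y = x √(1 - q) / 2`, with the normalization
`(q; q)_k` and `h_{2k}` in place of `[k]_q!` and `H_{2k}`. -/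
noncomputable def diagTerm (q y a : ℝ) (k : ℕ) : ℝ :=
  qPochInf (a * q ^ (k + 1)) q / qPochFin q q k * (a ^ k * qHermiteCont q y (2 * k))

/-- The `q`-Zeilberger certificate of `diagTerm`: its forward difference is the defect of the
`q`-difference equation in the parameter `a`. -/
noncomputable def diagCert (q y a : ℝ) (k : ℕ) : ℝ :=
  qPochInf (a * q ^ (k + 1)) q / qPochFin q q k *
    ((a * (4 * y ^ 2 - 2 + q ^ (2 * k) + q ^ (2 * k + 1)) - (1 - q ^ k) * (1 - a * q ^ k)) *
        (a ^ k * qHermiteCont q y (2 * k)) -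
      a ^ (k + 1) * qHermiteCont q y (2 * (k + 1)))

section Diagonal

variable {q y a : ℝ}

theorem tendsto_qPochInf_mul_pow_div_qPochFin (hq : |q| < 1) (a : ℝ) :
    Tendsto (fun k : ℕ => qPochInf (a * q ^ (k + 1)) q / qPochFin q q k) atTop
      (𝓝 (qPochInf q q)⁻¹) := by
  simpa only [one_mul, div_eq_mul_inv] using
    ((tendsto_add_atTop_iff_nat 1).mpr (tendsto_qPochInf_mul_pow hq a)).mul
      (tendsto_qPochFin_inv hq)

theorem exists_abs_qPochInf_div_qPochFin_le (hq : |q| < 1) (R : ℝ) :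
    ∃ M, ∀ b, |b| ≤ R → ∀ k, |qPochInf b q / qPochFin q q k| ≤ M := by
  obtain ⟨M, hM⟩ := (tendsto_qPochFin_inv hq).abs.bddAbove_range
  refine ⟨Real.exp (R * (1 - |q|)⁻¹) * M, fun b hb k => ?_⟩
  have : 0 ≤ (1 - |q|)⁻¹ := inv_nonneg.mpr (sub_nonneg.mpr hq.le)
  rw [div_eq_mul_inv, abs_mul]
  gcongr
  · exact (abs_qPochInf_le hq b).trans (by gcongr)
  · exact hM ⟨k, rfl⟩

theorem summable_diagTerm_iff (hq : |q| < 1) :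
    Summable (diagTerm q y a) ↔ Summable fun k => a ^ k * qHermiteCont q y (2 * k) := by
  have hc : (qPochInf q q)⁻¹ ≠ 0 := inv_ne_zero (qPochInf_ne_zero hq hq)
  have hequiv := ((Asymptotics.isEquivalent_const_iff_tendsto hc).mpr
    (tendsto_qPochInf_mul_pow_div_qPochFin hq a)).mul
      (Asymptotics.IsEquivalent.refl (u := fun k => a ^ k * qHermiteCont q y (2 * k)))
  exact hequiv.isTheta.summable_iff_nat.trans (summable_mul_left_iff hc)

theorem summable_diagTerm_mul_pow (hq : |q| < 1) (hs : Summable (diagTerm q y a)) (n : ℕ) :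
    Summable (diagTerm q y (a * q ^ n)) := by
  rw [summable_diagTerm_iff hq] at hs ⊢
  refine hs.norm.of_norm_bounded fun k => ?_
  rw [norm_mul, norm_mul, norm_pow, norm_pow]
  gcongr
  exact abs_mul_pow_le hq.le a n

theorem summable_diagCert (hq : |q| < 1) (hs : Summable (diagTerm q y a)) :
    Summable (diagCert q y a) := by
  rw [summable_diagTerm_iff hq] at hs
  have hpow : Tendsto (fun k : ℕ => q ^ k) atTop (𝓝 0) :=
    tendsto_pow_atTop_nhds_zero_of_abs_lt_one hq
  have hpow2 : Tendsto (fun k : ℕ => q ^ (2 * k)) atTop (𝓝 0) :=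
    hpow.comp (tendsto_id.const_mul_atTop' two_pos)
  have hcoef := (((((hpow2.const_add (4 * y ^ 2 - 2)).add (hpow2.mul_const q)).const_mul a)).sub
    ((hpow.const_sub 1).mul ((hpow.const_mul a).const_sub 1)))
  have hweight := tendsto_qPochInf_mul_pow_div_qPochFin hq a
  have h := (summable_mul_of_tendsto hs (hweight.mul hcoef)).sub
    (summable_mul_of_tendsto ((summable_nat_add_iff 1).mpr hs) hweight)
  refine h.congr fun k => ?_
  rw [diagCert]
  ring

theorem diagCert_zero (q y a : ℝ) : diagCert q y a 0 = 0 := by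
  simp only [diagCert, mul_zero, zero_add, mul_one, qHermiteCont]
  ring

theorem diagCert_succ_sub (hq : |q| < 1) (y a : ℝ) (k : ℕ) :
    diagCert q y a (k + 1) - diagCert q y a k =
      lFactor y a * diagTerm q y a k - (1 + a) * (1 - a ^ 2 * q) * diagTerm q y (a * q) k := by
  have hP : qPochInf (a * q ^ (k + 1)) q =
      (1 - a * q ^ (k + 1)) * qPochInf (a * q ^ (k + 2)) q := by
    rw [qPochInf_eq_one_sub_mul hq, mul_assoc a, ← pow_succ]
  have hP' : a * q * q ^ (k + 1) = a * q ^ (k + 2) := by ring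
  have hD : qPochFin q q k ≠ 0 := qPochFin_ne_zero hq hq k
  have hD1 : 1 - q * q ^ k ≠ 0 := one_sub_mul_pow_ne_zero hq hq k
  simp only [diagCert, diagTerm, lFactor, add_assoc, Nat.reduceAdd]
  rw [hP', hP, qPochFin_succ, qHermiteCont_even_recurrence]
  field_simp
  ring

theorem lFactor_mul_tsum_diagTerm (hq : |q| < 1) (hs : Summable (diagTerm q y a)) :
    lFactor y a * ∑' k, diagTerm q y a k =
      (1 + a) * (1 - a ^ 2 * q) * ∑' k, diagTerm q y (a * q) k := by
  have hsq : Summable (diagTerm q y (a * q)) := by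
    simpa only [pow_one] using summable_diagTerm_mul_pow hq hs 1
  have hG := summable_diagCert hq hs
  have htelescope : ∑' k, (diagCert q y a (k + 1) - diagCert q y a k) = 0 := by
    rw [((summable_nat_add_iff 1).mpr hG).tsum_sub hG, hG.tsum_eq_zero_add, diagCert_zero, zero_add,
      sub_self]
  simp only [diagCert_succ_sub hq] at htelescope
  rwa [(hs.mul_left _).tsum_sub (hsq.mul_left _), tsum_mul_left, tsum_mul_left, sub_eq_zero]
    at htelescope

theorem prod_lFactor_mul_tsum_diagTerm (hq : |q| < 1) (hs : Summable (diagTerm q y a)) (n : ℕ) :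
    (∏ k ∈ range n, lFactor y (a * q ^ k)) * ∑' k, diagTerm q y a k =
      qPochFin (-a) q n * qPochFin (a ^ 2 * q) (q ^ 2) n *
        ∑' k, diagTerm q y (a * q ^ n) k := by
  induction n with
  | zero => simp
  | succ n ih =>
    have h := lFactor_mul_tsum_diagTerm hq (summable_diagTerm_mul_pow hq hs n)
    rw [mul_assoc a, ← pow_succ] at h
    rw [prod_range_succ, qPochFin_succ, qPochFin_succ]
    linear_combination lFactor y (a * q ^ n) * ih +
      qPochFin (-a) q n * qPochFin (a ^ 2 * q) (q ^ 2) n * h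

theorem tendsto_tsum_diagTerm_mul_pow (hq : |q| < 1) (hs : Summable (diagTerm q y a)) :
    Tendsto (fun n : ℕ => ∑' k, diagTerm q y (a * q ^ n) k) atTop (𝓝 1) := by
  obtain ⟨M, hM⟩ := exists_abs_qPochInf_div_qPochFin_le hq |a|
  have hlim : Tendsto (fun n : ℕ => a * q ^ n) atTop (𝓝 0) := tendsto_mul_pow_nhds_zero hq a
  have h := tendsto_tsum_of_dominated_convergence (𝓕 := atTop)
    (f := fun n k => diagTerm q y (a * q ^ n) k)
    (g := fun k => 1 / qPochFin q q k * (0 ^ k * qHermiteCont q y (2 * k)))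
    (((summable_diagTerm_iff hq).mp hs).norm.mul_left M) (fun k => ?_)
    (Eventually.of_forall fun n k => ?_)
  · rwa [tsum_eq_single 0 fun k hk => by simp [hk], qPochFin_zero, mul_zero, qHermiteCont, pow_zero,
      mul_one, mul_one, div_one] at h
  · have hP : Tendsto (fun n : ℕ => qPochInf (a * q ^ n * q ^ (k + 1)) q) atTop (𝓝 1) :=
      (tendsto_qPochInf_nhds_zero hq).comp (by simpa using hlim.mul_const (q ^ (k + 1)))
    exact (hP.div_const _).mul ((hlim.pow k).mul_const _)
  · have hn : |a * q ^ n| ≤ |a| := abs_mul_pow_le hq.le a n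
    rw [diagTerm, norm_mul, norm_mul, norm_mul, norm_pow, norm_pow]
    gcongr
    · exact (abs_nonneg _).trans (hM a le_rfl 0)
    · exact hM _ ((abs_mul_pow_le hq.le _ _).trans hn) k
    · exact hn

theorem multipliable_lFactor (hq : |q| < 1) (y a : ℝ) :
    Multipliable fun k : ℕ => lFactor y (a * q ^ k) := by
  have hlim := (tendsto_mul_pow_nhds_zero hq a).const_add (2 - 4 * y ^ 2)
  have h := summable_mul_of_tendsto (hasSum_abs_mul_pow hq a).summable.of_abs hlim
  refine (multipliable_one_add_of_summable h.norm).congr fun k => ?_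
  rw [lFactor]
  ring

theorem qPochInf_mul_tprod_lFactor_mul_tsum_diagTerm (hq : |q| < 1)
    (hs : Summable (diagTerm q y a)) :
    qPochInf a q * (∏' k : ℕ, lFactor y (a * q ^ k)) * ∑' k, diagTerm q y a k =
      qPochInf (a ^ 2) q := by
  have hq2 : |q ^ 2| < 1 := by simpa only [abs_pow] using pow_lt_one₀ (abs_nonneg q) hq two_ne_zero
  have hleft := (multipliable_lFactor hq y a).hasProd.tendsto_prod_nat.mul_const
    (∑' k, diagTerm q y a k)
  have hright := ((tendsto_qPochFin hq (-a)).mul (tendsto_qPochFin hq2 (a ^ 2 * q))).mul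
    (tendsto_tsum_diagTerm_mul_pow hq hs)
  have h := tendsto_nhds_unique hleft
    (hright.congr fun n => (prod_lFactor_mul_tsum_diagTerm hq hs n).symm)
  rw [mul_assoc, h, mul_one, ← mul_assoc, qPochInf_mul_qPochInf_neg hq,
    qPochInf_sq_mul_qPochInf_sq hq]

theorem tprod_lFactor_ne_zero (hq : |q| < 1) (ha : |a| < 1) (hs : Summable (diagTerm q y a)) :
    ∏' k : ℕ, lFactor y (a * q ^ k) ≠ 0 := by
  have ha2 : |a ^ 2| < 1 := by simpa only [abs_pow] using pow_lt_one₀ (abs_nonneg a) ha two_ne_zero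
  have h := qPochInf_ne_zero hq ha2
  rw [← qPochInf_mul_tprod_lFactor_mul_tsum_diagTerm hq hs] at h
  exact right_ne_zero_of_mul (left_ne_zero_of_mul h)

end Diagonal

theorem abs_mul_sqrt_div_two_le_one {q x : ℝ} (hq : q < 1) (hx : x ∈ supportS q) :
    |x * √(1 - q) / 2| ≤ 1 := by
  have hs : 0 < √(1 - q) := Real.sqrt_pos.mpr (sub_pos.mpr hq)
  obtain ⟨hlo, hhi⟩ := hx
  rw [div_le_iff₀ hs] at hlo
  rw [le_div_iff₀ hs] at hhi
  exact abs_le.mpr ⟨by linarith, by linarith⟩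

theorem diagTerm_eq_mul_qHermite {q : ℝ} (hq : q < 1) (ρ x : ℝ) (k : ℕ) :
    diagTerm q (x * √(1 - q) / 2) ρ k =
      ρ ^ k * qPochInf (ρ * q ^ (k + 1)) q / qFact q k * qHermite q (2 * k) x := by
  rw [diagTerm, qHermite_two_mul hq, ← qFact_mul_one_sub_pow, div_mul_div_comm]
  ring

theorem mainTheorem4_general (q ρ x : ℝ) (hq : |q| < 1) (hρ : |ρ| < 1)
    (hs : Summable fun k : ℕ =>
      ρ ^ k * qPochInf (ρ * q ^ (k + 1)) q / qFact q k * qHermite q (2 * k) x) :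
    qPochInf ρ q ≠ 0 ∧
    (∀ k : ℕ, LFactor q x (ρ * q ^ k) ≠ 0) ∧
    Multipliable (fun k : ℕ => (LFactor q x (ρ * q ^ k))⁻¹) ∧
    HasSum
      (fun k : ℕ => ρ ^ k * qPochInf (ρ * q ^ (k + 1)) q / qFact q k * qHermite q (2 * k) x)
      (qPochInf (ρ ^ 2) q / qPochInf ρ q * ∏' k : ℕ, (LFactor q x (ρ * q ^ k))⁻¹) := by
  simp only [← diagTerm_eq_mul_qHermite (abs_lt.mp hq).2, LFactor] at hs ⊢
  have hP := qPochInf_ne_zero hq hρ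
  have hM := multipliable_lFactor hq (x * √(1 - q) / 2) ρ
  have hL := tprod_lFactor_ne_zero hq hρ hs
  refine ⟨hP, fun k hk => hL (tprod_of_exists_eq_zero ⟨k, hk⟩), hM.inv₀ hL, ?_⟩
  convert hs.hasSum using 1
  rw [hM.tprod_inv₀ hL, ← qPochInf_mul_tprod_lFactor_mul_tsum_diagTerm hq hs]
  field_simp

/-- The sum along the diagonal in terms of `q`-Hermite polynomials of even degree. The first three
conjuncts say that the right-hand side of the identity is meaningful: no divisor vanishes and the
infinite product converges; the last says that the series converges and has the asserted sum. -/
theorem mainTheorem4 (q ρ x : ℝ) (hq : |q| < 1) (hρ : |ρ| < 1) (hx : x ∈ supportS q) :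
    qPochInf ρ q ≠ 0 ∧
    (∀ k : ℕ, LFactor q x (ρ * q ^ k) ≠ 0) ∧
    Multipliable (fun k : ℕ => (LFactor q x (ρ * q ^ k))⁻¹) ∧
    HasSum
      (fun k : ℕ => ρ ^ k * qPochInf (ρ * q ^ (k + 1)) q / qFact q k * qHermite q (2 * k) x)
      (qPochInf (ρ ^ 2) q / qPochInf ρ q * ∏' k : ℕ, (LFactor q x (ρ * q ^ k))⁻¹) := by
  refine mainTheorem4_general q ρ x hq hρ ?_
  simp only [← diagTerm_eq_mul_qHermite (abs_lt.mp hq).2]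
  exact (summable_diagTerm_iff hq).mpr (summable_pow_mul_qHermiteCont_two_mul hq hρ
    (abs_mul_sqrt_div_two_le_one (abs_lt.mp hq).2 hx))
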